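/- Let $\mathbf T,\mathbf Y$ be measurable spaces, $\mathbf X=\mathbf T\times\mathbf Y$, and let $\mu,\nu$ be probability measures on $\mathbf X$ with $\nu\ll\mu$ and density $w=\frac{d\nu}{d\mu}:\mathbf X\to[0,\infty)$. Write $\mu^*,\nu^*$ for the marginals on $\mathbf T$ and $w^*=\frac{d\nu^*}{d\mu^*}$. For a Markov kernel $K$ with invariant probability $\mu$ and $f\in L^2(\mu)$ set $$\mathcal E_K(f)=\int f\,(f-Kf)\,d\mu,\qquad \mathrm{var}(K,f)=\lim_{n\to\infty}\frac1n\,\mathbb E\Big[\Big(\sum_{k=1}^n [f(X_k)-\mu(f)]\Big)^2\Big]\in[0,\infty],$$ where $(X_k)$ is the stationary chain with transition $K$ and $X_0\sim\mu$. Call $K$ positive if $\int f\,Kf\,d\mu\ge 0$ for all $f\in L^2(\mu)$, and put $\mathscr N_K=0$ if $K$ is positive and $\mathscr N_K=1$ otherwise. A chain is $\mu$-Harris ergodic if it is $\mu$-invariant, $\psi$-irreducible and Harris recurrent. Let $K$ and $L$ be Markov kernels on $\mathbf X$, reversible with respect to $\mu$ and $\nu$ and Harris ergodic for $\mu$ and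 $\nu$, respectively, and let $\underline c,\overline c\ge 0$ be constants such that (a) $\underline c\,\mathcal E_K(g)\le \mathcal E_L(g)\le\overline c\,\mathcal E_K(g)$ for all $g\in L^2(\mu^*)$ (regarded as functions $g(\theta,y)=g(\theta)$ on $\mathbf X$), and (b) $\underline c\le w^*\le\overline c$ $\mu^*$-a.e. Suppose that $K$ is an augmented kernel: there are a Markov kernel $\dot K$ on $\mathbf T$ with invariant probability $\dot\mu$ and a probability kernel $Q$ from $\mathbf T$ to $\mathbf Y$ with $$K_{\theta y}(d\theta',dy')=\dot K_\theta(d\theta')\,Q_{\theta'}(dy'),\qquad \mu(d\theta,dy)=\dot\mu(d\theta)\,Q_\theta(dy).$$ Let $\varphi\in L^2(\nu)$, $\bar\varphi=\varphi-\nu(\varphi)$, and suppose $w\bar\varphi\in L^2(\mu)$. Then the limits $\mathrm{var}(K,w\bar\varphi)$ and $\mathrm{var}(L,\varphi)$ exist in $[0,\infty]$ and $$\mathrm{var}(K,w\bar\varphi)\le\overline c\,\big[\mathrm{var}(L,\varphi)+\mathrm{var}_\nu(\varphi)\big]+(1+2\mathscr N_K)\,\mathrm{var}_\mu(w\bar\varphi).$$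 Moreover, if $w\bar\varphi$ depends only on $\theta\in\mathbf T$ ($\mu$-a.e.), then $$\mathrm{var}(K,w\bar\varphi)+\mathrm{var}_\mu(w\bar\varphi)\le\overline c\,\big[\mathrm{var}(L,\varphi)+\mathrm{var}_\nu(\varphi)\big].$$ -/

import Mathlib

open MeasureTheory ProbabilityTheory Filter Topology
open scoped ENNReal NNReal

namespace PeskunIS

noncomputable section

variable {X : Type*} [MeasurableSpace X]

/-- The law on path space `ℕ → X` of the homogeneous Markov chain with initial law `μ₀` and
transition kernel `K` (Ionescu-Tulcea). -/
def chainLaw (μ₀ : Measure X) (K : Kernel X X) [IsMarkovKernel K] : Measure (ℕ → X) :=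
  Kernel.trajMeasure (X := fun _ => X) μ₀
    (fun n => K.comap (fun h : (i : Finset.Iic n) → X => h ⟨n, Finset.mem_Iic.mpr le_rfl⟩)
      (measurable_pi_apply _))

/-- `ψ` is a maximal irreducibility measure of `K`: it is nontrivial, `K` is `ψ`-irreducible, and
`ψ` dominates every measure with respect to which `K` is irreducible. -/
structure IsMaximalIrreducibilityMeasure (K : Kernel X X) (ψ : Measure X) : Prop where
  sigmaFinite : SigmaFinite ψ
  ne_zero : ψ ≠ 0
  irreducible : Kernel.IsIrreducible ψ K
  maximal : ∀ ψ' : Measure X, Kernel.IsIrreducible ψ' K → ψ' ≪ ψ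

/-- Harris recurrence: `K` is `ψ`-irreducible and, with `ψ` a maximal irreducibility measure, every
measurable set `A` with `ψ A > 0` is almost surely visited infinitely often by the chain started
from any point of `A`. -/
def IsHarrisRecurrent (K : Kernel X X) [IsMarkovKernel K] : Prop :=
  ∃ ψ : Measure X, IsMaximalIrreducibilityMeasure K ψ ∧
    ∀ A : Set X, MeasurableSet A → 0 < ψ A → ∀ x ∈ A,
      ∀ᵐ ω ∂(chainLaw (Measure.dirac x) K), ∃ᶠ n in atTop, ω n ∈ A

/-- `μ`-Harris ergodicity: `μ`-invariant, `ψ`-irreducible and Harris recurrent. -/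
structure IsHarrisErgodic (K : Kernel X X) [IsMarkovKernel K] (μ : Measure X) : Prop where
  invariant : K.Invariant μ
  harris : IsHarrisRecurrent K

/-- The normalised second moment `n⁻¹ 𝔼[(∑_{k=1}^n (f(X_k) - μ(f)))²]` for the stationary chain
`(X_k)` with transition `K` and `X_0 ∼ μ`. -/
def asymVarSeq (K : Kernel X X) [IsMarkovKernel K] (μ : Measure X) (f : X → ℝ) (n : ℕ) : ℝ≥0∞ :=
  (∫⁻ ω, ENNReal.ofReal ((∑ k ∈ Finset.Icc 1 n, (f (ω k) - ∫ x, f x ∂μ)) ^ 2)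
    ∂(chainLaw μ K)) / (n : ℝ≥0∞)

/-- `var(K, f)` exists in `[0, ∞]` and equals `v`. -/
def HasAsymVar (K : Kernel X X) [IsMarkovKernel K] (μ : Measure X) (f : X → ℝ) (v : ℝ≥0∞) :
    Prop :=
  Tendsto (asymVarSeq K μ f) atTop (𝓝 v)

/-- The Dirichlet form `⟨f, (1 - K) f⟩_μ`. -/
def dirichletForm (K : Kernel X X) (μ : Measure X) (f : X → ℝ) : ℝ :=
  ∫ x, f x * (f x - ∫ x', f x' ∂(K x)) ∂μ

/-- Positivity: `⟨f, K f⟩_μ ≥ 0` for all `f ∈ L²(μ)`. -/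
def IsPositive (K : Kernel X X) (μ : Measure X) : Prop :=
  ∀ f : X → ℝ, MemLp f 2 μ → 0 ≤ ∫ x, f x * (∫ x', f x' ∂(K x)) ∂μ

open scoped Classical in
/-- The constant `𝒩_K`: `0` if `K` is positive and `1` if not. -/
def negConst (K : Kernel X X) (μ : Measure X) : ℝ≥0∞ :=
  if IsPositive K μ then 0 else 1

/-- `ν ≪ μ` and `w : X → [0, ∞)` is (a measurable version of) the density `dν/dμ`. -/
structure IsISTriplet (μ ν : Measure X) (w : X → ℝ≥0) : Prop where
  measurable : Measurable w
  absolutelyContinuous : ν ≪ μ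
  rnDeriv_eq : ν.rnDeriv μ =ᵐ[μ] fun x => (w x : ℝ≥0∞)

variable {T Y : Type*} [MeasurableSpace T] [MeasurableSpace Y]

/-- The comparison assumption on `T × Y`, with the Dirichlet form and weight bounds imposed only
on functions of the first coordinate; `μ.fst`, `ν.fst` are the marginals `μ*`, `ν*` on `T`, and
`w* = dν*/dμ*`. -/
structure MarginalComparison (μ ν : Measure (T × Y)) (w : T × Y → ℝ≥0)
    (K L : Kernel (T × Y) (T × Y)) [IsMarkovKernel K] [IsMarkovKernel L] (cl cu : ℝ≥0) :
    Prop where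
  triplet : IsISTriplet μ ν w
  harris_K : IsHarrisErgodic K μ
  harris_L : IsHarrisErgodic L ν
  reversible_K : K.IsReversible μ
  reversible_L : L.IsReversible ν
  dirichlet_lower : ∀ g : T → ℝ, MemLp g 2 μ.fst →
    (cl : ℝ) * dirichletForm K μ (fun x => g x.1) ≤ dirichletForm L ν (fun x => g x.1)
  dirichlet_upper : ∀ g : T → ℝ, MemLp g 2 μ.fst →
    dirichletForm L ν (fun x => g x.1) ≤ (cu : ℝ) * dirichletForm K μ (fun x => g x.1)
  weight_lower : ∀ᵐ t ∂μ.fst, (cl : ℝ≥0∞) ≤ ν.fst.rnDeriv μ.fst t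
  weight_upper : ∀ᵐ t ∂μ.fst, ν.fst.rnDeriv μ.fst t ≤ (cu : ℝ≥0∞)

/-- `(K, μ)` is the `Q`-augmentation of a Markov kernel `K'` on `T` with invariant probability
`μ'`: `K_{(t,y)}(dt', dy') = K'_t(dt') Q_{t'}(dy')` and `μ(dt, dy) = μ'(dt) Q_t(dy)`. -/
structure IsAugmentation (K : Kernel (T × Y) (T × Y)) (μ : Measure (T × Y))
    (K' : Kernel T T) (μ' : Measure T) (Q : Kernel T Y) : Prop where
  markov_base : IsMarkovKernel K'
  markov_aux : IsMarkovKernel Q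
  prob_base : IsProbabilityMeasure μ'
  invariant_base : K'.Invariant μ'
  kernel_eq : ∀ t y, K (t, y) = (K' t) ⊗ₘ Q
  measure_eq : μ = μ' ⊗ₘ Q

/-- The centred weighted function `w φ̄`, where `φ̄ = φ - ν(φ)`. -/
def weightedCentred (ν : Measure X) (w : X → ℝ≥0) (φ : X → ℝ) : X → ℝ :=
  fun x => (w x : ℝ) * (φ x - ∫ z, φ z ∂ν)

end

end PeskunIS

/-! A reversible kernel acts on `L²` of its invariant law as a symmetric contraction `P`. For
centred `f` in that space, `var(P, f) = ⟪f, (1 + P)(1 - P)⁻¹ f⟫`, which here takes the form `∑ⱼ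
‖Pʲ(f + P f)‖²`, a series of nonnegative terms that makes sense with value `∞` and needs no spectral
theorem. Since `(1 + P)(1 - P)⁻¹ + 1 = 2(1 - P)⁻¹`, there is the variational formula `var(P, f) +
‖f‖² = 2 sup_g (2⟪f, g⟫ - ⟪g, (1 - P) g⟫)`. An upper bound on Dirichlet forms therefore compares
variances (`tsum_varTerm_add_le`), and if `f` and the range of `P` lie in a subspace, test vectors
from that subspace suffice.

For an augmented kernel the range of `K` consists of functions of `θ`, exactly those for which
Dirichlet forms are controlled. The function `f = w φ̄` need not depend on `θ`, so it is replaced by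
its conditional mean `Q f` given `θ`. This leaves `K f` unchanged, and hence `var(K, f) + ‖Q f‖² =
var(K, Q f) + ‖f‖²` (`tsum_varTerm_add_norm_sq`). For a test function `g` of `θ`, `⟪Q f, g⟫_μ = ⟪f,
g⟫_μ = ⟪φ̄, g⟫_ν`, so `Q f` for `K` is compared with `φ̄` for `L` (`tsum_varTerm_refresh_le`). If
`f` depends only on `θ`, then `Q f = f` and no correction is needed. -/

namespace PeskunIS

/-! ### Variational formula and variance comparison for symmetric contractions -/

section Hilbert

variable {H : Type*} [NormedAddCommGroup H] [InnerProductSpace ℝ H]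

local notation "⟪" x ", " y "⟫" => inner ℝ x y

/-- The `j`-th term of the series of squares whose sum is the asymptotic variance. -/
noncomputable def varTerm (P : Module.End ℝ H) (f : H) (j : ℕ) : ℝ :=
  ‖(P ^ j) (f + P f)‖ ^ 2

/-- The partial solutions of the Poisson equation `(1 - P) u = f`. -/
noncomputable def poissonApprox (P : Module.End ℝ H) (f : H) (n : ℕ) : H :=
  (2⁻¹ : ℝ) • (f + ∑ i ∈ Finset.range n, (P ^ (2 * i)) (f + P f + P (f + P f)))

/-- The remainder in the Poisson equation. -/
noncomputable def poissonRemainder (P : Module.End ℝ H) (f : H) (n : ℕ) : H :=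
  (2⁻¹ : ℝ) • (P ^ (2 * n)) (f + P f)

lemma varTerm_nonneg (P : Module.End ℝ H) (f : H) (j : ℕ) : 0 ≤ varTerm P f j := sq_nonneg _

lemma inner_pow_pow {P : Module.End ℝ H} (hP : P.IsSymmetric) (x y : H) (i j : ℕ) :
    ⟪(P ^ i) x, (P ^ j) y⟫ = ⟪x, (P ^ (i + j)) y⟫ := by
  rw [hP.pow i, pow_add]; rfl

lemma varTerm_eq {P : Module.End ℝ H} (hP : P.IsSymmetric) (f : H) (j : ℕ) :
    varTerm P f j = ⟪f, (P ^ (2 * j)) f⟫ + 2 * ⟪f, (P ^ (2 * j + 1)) f⟫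
      + ⟪f, (P ^ (2 * j + 2)) f⟫ := by
  have h1 : (P ^ j) (f + P f) = (P ^ j) f + (P ^ (j + 1)) f := by
    rw [map_add, pow_succ]; rfl
  rw [varTerm, h1, ← real_inner_self_eq_norm_sq]
  simp only [inner_add_left, inner_add_right, inner_pow_pow hP]
  rw [show j + 1 + (j + 1) = 2 * j + 2 by ring, show j + (j + 1) = 2 * j + 1 by ring,
    show j + 1 + j = 2 * j + 1 by ring, show j + j = 2 * j by ring]
  ring

lemma inner_pow_even {P : Module.End ℝ H} (hP : P.IsSymmetric) (f : H) (j : ℕ) :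
    ⟪f, (P ^ (2 * j)) f⟫ = ‖(P ^ j) f‖ ^ 2 := by
  rw [← real_inner_self_eq_norm_sq, inner_pow_pow hP, two_mul]

lemma norm_pow_apply_le {P : Module.End ℝ H} (hc : ∀ x, ‖P x‖ ≤ ‖x‖) (f : H) (j : ℕ) :
    ‖(P ^ j) f‖ ≤ ‖f‖ := by
  induction j with
  | zero => simp
  | succ j ih => rw [pow_succ']; exact (hc _).trans ih

lemma inner_add_apply_nonneg {P : Module.End ℝ H} (hc : ∀ x, ‖P x‖ ≤ ‖x‖) (x : H) :
    0 ≤ ⟪x, x + P x⟫ := by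
  rw [inner_add_right, real_inner_self_eq_norm_sq]
  have := (abs_le.1 (abs_real_inner_le_norm x (P x))).1
  nlinarith [hc x, norm_nonneg x]

lemma inner_sub_apply_nonneg {P : Module.End ℝ H} (hc : ∀ x, ‖P x‖ ≤ ‖x‖) (x : H) :
    0 ≤ ⟪x, x - P x⟫ := by
  rw [inner_sub_right, real_inner_self_eq_norm_sq]
  have := (abs_le.1 (abs_real_inner_le_norm x (P x))).2
  nlinarith [hc x, norm_nonneg x]

lemma pow_apply_comm (P : Module.End ℝ H) (i : ℕ) (x : H) : (P ^ i) (P x) = P ((P ^ i) x) := by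
  rw [← Module.End.mul_apply, ← Module.End.mul_apply, pow_mul_comm']

/-- Formally `(1 - P)⁻¹ = ½(1 + (1 + P)² ∑ᵢ P²ⁱ)`. After truncation the geometric series telescopes,
and only the remainder is left. -/
lemma poissonApprox_sub {P : Module.End ℝ H} (f : H) (n : ℕ) :
    poissonApprox P f n - P (poissonApprox P f n) = f - poissonRemainder P f n := by
  induction n with
  | zero =>
    simp only [poissonApprox, poissonRemainder, Finset.range_zero, Finset.sum_empty, add_zero,
      map_smul, mul_zero, pow_zero, Module.End.one_apply, smul_add]
    module
  | succ n ih =>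
    have h : poissonApprox P f (n + 1) = poissonApprox P f n
        + (2⁻¹ : ℝ) • (P ^ (2 * n)) (f + P f + P (f + P f)) := by
      simp only [poissonApprox, Finset.sum_range_succ, ← add_assoc, smul_add]
    rw [h, P.map_add (poissonApprox P f n), add_sub_add_comm, ih]
    simp only [poissonRemainder, map_add, map_smul, pow_apply_comm, mul_add, pow_succ,
      Module.End.mul_apply, mul_one]
    module

lemma inner_poissonApprox {P : Module.End ℝ H} (hP : P.IsSymmetric) (f : H) (n : ℕ) :
    2 * ⟪f, poissonApprox P f n⟫ = ‖f‖ ^ 2 + ∑ j ∈ Finset.range n, varTerm P f j := by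
  rw [poissonApprox, inner_smul_right, inner_add_right, inner_sum, real_inner_self_eq_norm_sq,
    mul_inv_cancel_left₀ two_ne_zero]
  congr 1
  refine Finset.sum_congr rfl fun j _ => ?_
  rw [varTerm_eq hP]
  simp only [map_add, inner_add_right, pow_succ, Module.End.mul_apply]
  ring

/-- Only even powers occur, so by symmetry each cross term becomes `⟪z, z + P z⟫` with `z = P^(i+j)
x`, which is nonnegative for a contraction. This sign lets both halves of the variational formula
work with a truncated solution. -/
lemma inner_poissonApprox_remainder_nonneg {P : Module.End ℝ H} (hP : P.IsSymmetric)
    (hc : ∀ x, ‖P x‖ ≤ ‖x‖) (f : H) (n : ℕ) :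
    0 ≤ ⟪poissonApprox P f n, poissonRemainder P f n⟫ := by
  have key : ∀ (x : H) (i j : ℕ), 0 ≤ ⟪(P ^ (2 * i)) x, (P ^ (2 * j)) (x + P x)⟫ := by
    intro x i j
    have := inner_add_apply_nonneg hc ((P ^ (i + j)) x)
    rw [← pow_apply_comm, ← map_add, inner_pow_pow hP] at this
    rw [inner_pow_pow hP]
    convert this using 3
    ring_nf
  rw [poissonApprox, poissonRemainder, inner_smul_left, inner_smul_right, inner_add_left,
    sum_inner]
  have h0 := key f 0 n
  rw [mul_zero, pow_zero, Module.End.one_apply] at h0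
  have h1 : ∀ i ∈ Finset.range n,
      0 ≤ ⟪(P ^ (2 * i)) (f + P f + P (f + P f)), (P ^ (2 * n)) (f + P f)⟫ := by
    intro i _
    have := key (f + P f) n i
    rwa [real_inner_comm] at this
  have := Finset.sum_nonneg h1
  simp only [conj_trivial]
  positivity

/-- The partial sums of the variance series are attained by the quadratic functional. -/
lemma norm_sq_add_sum_varTerm_le {P : Module.End ℝ H} (hP : P.IsSymmetric)
    (hc : ∀ x, ‖P x‖ ≤ ‖x‖) (f : H) (n : ℕ) :
    ‖f‖ ^ 2 + ∑ j ∈ Finset.range n, varTerm P f j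
      ≤ 2 * (2 * ⟪f, poissonApprox P f n⟫
        - ⟪poissonApprox P f n, poissonApprox P f n - P (poissonApprox P f n)⟫) := by
  have h1 := inner_poissonApprox hP f n
  have h2 := inner_poissonApprox_remainder_nonneg hP hc f n
  have h3 := real_inner_comm f (poissonApprox P f n)
  rw [poissonApprox_sub, inner_sub_right]
  linarith

/-- The quadratic functional is bounded by the sum of the variance series. -/
lemma two_mul_functional_le {P : Module.End ℝ H} (hP : P.IsSymmetric)
    (hc : ∀ x, ‖P x‖ ≤ ‖x‖) (f g : H) (hs : Summable (varTerm P f)) :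
    2 * (2 * ⟪f, g⟫ - ⟪g, g - P g⟫) ≤ ‖f‖ ^ 2 + ∑' j, varTerm P f j := by
  -- Completing the square: expand `⟪g - u, (1 - P)(g - u)⟫ ≥ 0` with `u` the approximate solution.
  -- The remainder `h` costs `4⟪h, g⟫`, and `2‖h‖` is the square root of the term of index `2n`,
  -- which vanishes in the limit by summability.
  have hbound : ∀ n, 2 * (2 * ⟪f, g⟫ - ⟪g, g - P g⟫)
      ≤ ‖f‖ ^ 2 + ∑' j, varTerm P f j + 2 * (‖g‖ * √(varTerm P f (2 * n))) := by
    intro n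
    set u := poissonApprox P f n with hu
    set h := poissonRemainder P f n with hh
    have e1 : u - P u = f - h := poissonApprox_sub f n
    have e2 := inner_poissonApprox hP f n
    have e3 := inner_poissonApprox_remainder_nonneg hP hc f n
    rw [← hu] at e2 e3
    rw [← hh] at e3
    have e4 := inner_sub_apply_nonneg hc (g - u)
    have e5 : g - u - P (g - u) = (g - P g) - (f - h) := by
      rw [← e1, map_sub]; abel
    have e6 : ⟪u, g - P g⟫ = ⟪f - h, g⟫ := by
      rw [← e1, inner_sub_right, inner_sub_left, hP]
    rw [e5] at e4
    simp only [inner_sub_left, inner_sub_right] at e4 e6 ⊢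
    have e7 : 2 * ‖h‖ = √(varTerm P f (2 * n)) := by
      rw [hh, poissonRemainder, norm_smul, varTerm, Real.sqrt_sq (norm_nonneg _),
        Real.norm_of_nonneg (by norm_num), mul_inv_cancel_left₀ two_ne_zero]
    have e8 := (abs_le.1 (abs_real_inner_le_norm g h)).2
    rw [← e7]
    have e9 := hs.sum_le_tsum (Finset.range n) fun j _ => varTerm_nonneg P f j
    have c1 := real_inner_comm f g
    have c2 := real_inner_comm h g
    have c3 := real_inner_comm f u
    linarith
  have hlim : Tendsto (fun n : ℕ => ‖f‖ ^ 2 + ∑' j, varTerm P f j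
      + 2 * (‖g‖ * √(varTerm P f (2 * n)))) atTop
      (𝓝 (‖f‖ ^ 2 + ∑' j, varTerm P f j + 2 * (‖g‖ * √0))) := by
    have h2 : Tendsto (fun n : ℕ => 2 * n) atTop atTop :=
      tendsto_id.const_mul_atTop' two_pos
    exact (((hs.tendsto_atTop_zero.comp h2).sqrt.const_mul _).const_mul _).const_add _
  have := ge_of_tendsto' hlim hbound
  simpa using this

lemma varTerm_congr_succ {P : Module.End ℝ H} {f f' : H} (h : P f = P f') (j : ℕ) :
    varTerm P f (j + 1) = varTerm P f' (j + 1) := by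
  simp only [varTerm, pow_succ, Module.End.mul_apply, map_add, h]

/-- By symmetry `⟪f, P f⟫ = ⟪f, P f'⟫ = ⟪P f, f'⟫ = ⟪f', P f'⟫`, so in the expansion of `‖f + P f‖²`
only `‖f‖²` can differ. -/
lemma varTerm_congr_zero {P : Module.End ℝ H} (hP : P.IsSymmetric) {f f' : H} (h : P f = P f') :
    varTerm P f 0 + ‖f'‖ ^ 2 = varTerm P f' 0 + ‖f‖ ^ 2 := by
  rw [varTerm_eq hP, varTerm_eq hP]
  have h2 : ⟪f, P f'⟫ = ⟪f', P f'⟫ := by rw [← hP, ← hP, h]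
  simp [pow_succ, h, h2]
  have h3 : ⟪f, P (P f')⟫ = ⟪f', P (P f')⟫ := by rw [← hP, ← hP f', h]
  rw [h3]
  ring

/-- Replacing `f` by `f'` with `P f = P f'` only changes the variance by the squared norms. -/
lemma tsum_varTerm_add_norm_sq {P : Module.End ℝ H} (hP : P.IsSymmetric) {f f' : H}
    (h : P f = P f') :
    ∑' j, ENNReal.ofReal (varTerm P f j) + ENNReal.ofReal (‖f'‖ ^ 2)
      = ∑' j, ENNReal.ofReal (varTerm P f' j) + ENNReal.ofReal (‖f‖ ^ 2) := by
  have hsplit : ∀ x : H, ∑' j, ENNReal.ofReal (varTerm P x j)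
      = ENNReal.ofReal (varTerm P x 0) + ∑' j, ENNReal.ofReal (varTerm P x (j + 1)) :=
    fun x => tsum_eq_zero_add' ENNReal.summable
  rw [hsplit f, hsplit f', add_right_comm,
    ← ENNReal.ofReal_add (varTerm_nonneg _ _ _) (sq_nonneg _), varTerm_congr_zero hP h,
    ENNReal.ofReal_add (varTerm_nonneg _ _ _) (sq_nonneg _), add_right_comm]
  simp only [varTerm_congr_succ h]

/-- Comparison of two variance series through a common family of test vectors. -/
lemma tsum_varTerm_add_le {H' : Type*} [NormedAddCommGroup H'] [InnerProductSpace ℝ H']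
    {P : Module.End ℝ H} {P' : Module.End ℝ H'} (hP : P.IsSymmetric) (hc : ∀ x, ‖P x‖ ≤ ‖x‖)
    (hP' : P'.IsSymmetric) (hc' : ∀ x, ‖P' x‖ ≤ ‖x‖) {S : Submodule ℝ H} (hS : ∀ x, P x ∈ S)
    {f : H} (hf : f ∈ S) {f' : H'} {c : ℝ≥0} (hc0 : c ≠ 0)
    (h : ∀ g ∈ S, ∃ g' : H', ⟪f', g'⟫ = ⟪f, g⟫ ∧ ⟪g', g' - P' g'⟫ ≤ c * ⟪g, g - P g⟫) :
    ∑' j, ENNReal.ofReal (varTerm P f j) + ENNReal.ofReal (‖f‖ ^ 2)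
      ≤ c * (∑' j, ENNReal.ofReal (varTerm P' f' j) + ENNReal.ofReal (‖f'‖ ^ 2)) := by
  -- In `ℝ≥0∞` the product `0 * ⊤` is `0`, so the infinite case needs `c ≠ 0`.
  by_cases htop : ∑' j, ENNReal.ofReal (varTerm P' f' j) = ⊤
  · rw [htop, top_add, ENNReal.mul_top (by exact_mod_cast hc0)]
    exact le_top
  have hs : Summable (varTerm P' f') := by
    have := ENNReal.summable_toReal htop
    simpa only [ENNReal.toReal_ofReal (varTerm_nonneg P' f' _)] using this
  have hcpos : (0 : ℝ) < c := by exact_mod_cast pos_iff_ne_zero.2 hc0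
  rw [← ENNReal.ofReal_tsum_of_nonneg (varTerm_nonneg P' f') hs,
    ← ENNReal.ofReal_add (tsum_nonneg (varTerm_nonneg P' f')) (sq_nonneg _),
    ← ENNReal.ofReal_coe_nnreal, ← ENNReal.ofReal_mul hcpos.le, ENNReal.tsum_eq_iSup_nat,
    ENNReal.iSup_add]
  refine iSup_le fun n => ?_
  rw [← ENNReal.ofReal_sum_of_nonneg fun i _ => varTerm_nonneg P f i,
    ← ENNReal.ofReal_add (Finset.sum_nonneg fun i _ => varTerm_nonneg P f i) (sq_nonneg _)]
  refine ENNReal.ofReal_le_ofReal ?_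
  have hpow : ∀ (i : ℕ) (x : H), x ∈ S → (P ^ i) x ∈ S := by
    intro i x hx
    cases i with
    | zero => simpa using hx
    | succ i => rw [pow_succ']; exact hS _
  have hu : poissonApprox P f n ∈ S :=
    S.smul_mem _ (S.add_mem hf (S.sum_mem fun i _ =>
      hpow _ _ (S.add_mem (S.add_mem hf (hS _)) (hS _))))
  -- The scaling by `c⁻¹` turns the factor `c` on the quadratic part into `c⁻¹`, matching the linear
  -- part. The functional for `P'` at `g'` is then at least `c⁻¹` times that for `P` at the
  -- approximate solution.
  obtain ⟨g', hg1, hg2⟩ := h ((c : ℝ)⁻¹ • poissonApprox P f n) (S.smul_mem _ hu)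
  have k1 := norm_sq_add_sum_varTerm_le hP hc f n
  have k2 := two_mul_functional_le hP' hc' f' g' hs
  set u := poissonApprox P f n
  rw [map_smul, ← smul_sub, inner_smul_left, inner_smul_right, conj_trivial,
    mul_inv_cancel_left₀ hcpos.ne'] at hg2
  rw [inner_smul_right] at hg1
  have k3 : 2 * (2 * ((c : ℝ)⁻¹ * ⟪f, u⟫) - (c : ℝ)⁻¹ * ⟪u, u - P u⟫)
      ≤ ‖f'‖ ^ 2 + ∑' j, varTerm P' f' j := by
    rw [← hg1]
    linarith
  have k4 := mul_le_mul_of_nonneg_left k3 hcpos.le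
  have k5 : (c : ℝ) * (2 * (2 * ((c : ℝ)⁻¹ * ⟪f, u⟫) - (c : ℝ)⁻¹ * ⟪u, u - P u⟫))
      = 2 * (2 * ⟪f, u⟫ - ⟪u, u - P u⟫) := by
    field_simp
  rw [k5] at k4
  rw [add_comm, add_comm (∑' j, varTerm P' f' j)]
  exact k1.trans k4

end Hilbert

/-! ### Existence of the asymptotic variance through Cesàro means -/

section Cesaro

/-- For the lower bound, fix `m`: the `n - m` terms from index `m` on are at least `u m`, and their
proportion tends to `1`. The value `⊤` is allowed. -/
lemma tendsto_cesaro_ennreal {u : ℕ → ℝ≥0∞} (hu : Monotone u) :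
    Tendsto (fun n : ℕ => (∑ m ∈ Finset.range n, u m) / n) atTop (𝓝 (⨆ m, u m)) := by
  refine tendsto_of_le_liminf_of_limsup_le ?_ ?_
  · refine iSup_le fun m => ?_
    have h1 : Tendsto (fun n : ℕ => u m * ((n - m : ℕ) / n : ℝ≥0∞)) atTop (𝓝 (u m * 1)) := by
      refine ENNReal.Tendsto.const_mul ?_ (Or.inl one_ne_zero)
      have h2 : Tendsto (fun n : ℕ => 1 - (m : ℝ≥0∞) / n) atTop (𝓝 (1 - 0)) := by
        refine ENNReal.Tendsto.sub tendsto_const_nhds ?_ (Or.inl ENNReal.one_ne_top)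
        exact ENNReal.Tendsto.const_div ENNReal.tendsto_nat_nhds_top
          (Or.inr (ENNReal.natCast_ne_top m)) |>.trans (by simp)
      rw [tsub_zero] at h2
      refine h2.congr' ?_
      filter_upwards [eventually_gt_atTop 0] with n hn
      have hn' : (n : ℝ≥0∞) ≠ 0 := by exact_mod_cast hn.ne'
      rw [ENNReal.natCast_sub, ENNReal.sub_div fun _ _ => hn',
        ENNReal.div_self hn' (ENNReal.natCast_ne_top n)]
    rw [mul_one] at h1
    rw [← h1.liminf_eq]
    refine liminf_le_liminf (Eventually.of_forall fun n => ?_)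
    rw [← mul_div_assoc]
    refine ENNReal.div_le_div_right ?_ _
    calc u m * (n - m : ℕ) = ∑ k ∈ Finset.Ico m n, u m := by
          rw [Finset.sum_const, Nat.card_Ico, nsmul_eq_mul, mul_comm]
      _ ≤ ∑ k ∈ Finset.Ico m n, u k :=
          Finset.sum_le_sum fun k hk => hu (Finset.mem_Ico.1 hk).1
      _ ≤ ∑ k ∈ Finset.range n, u k := by
          refine Finset.sum_le_sum_of_subset fun k hk => ?_
          exact Finset.mem_range.2 (Finset.mem_Ico.1 hk).2
  · refine limsup_le_of_le (h := Eventually.of_forall fun n => ?_)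
    refine ENNReal.div_le_of_le_mul ?_
    calc ∑ m ∈ Finset.range n, u m ≤ ∑ _m ∈ Finset.range n, ⨆ k, u k :=
          Finset.sum_le_sum fun k _ => le_iSup u k
      _ = _ := by rw [Finset.sum_const, Finset.card_range, nsmul_eq_mul, mul_comm]

lemma sum_Icc_sum_Icc_succ {G : ℕ → ℕ → ℝ} {a : ℕ → ℝ} (h1 : ∀ i k, G i (i + k) = a k)
    (h2 : ∀ i k, G (i + k) i = a k) (n : ℕ) :
    ∑ i ∈ Finset.Icc 1 (n + 1), ∑ j ∈ Finset.Icc 1 (n + 1), G i j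
      = ∑ i ∈ Finset.Icc 1 n, ∑ j ∈ Finset.Icc 1 n, G i j
        + (a 0 + 2 * ∑ k ∈ Finset.range n, a (k + 1)) := by
  -- Reversing the sum makes the lag between `n - k` and `n + 1` equal to `k + 1`.
  have r : ∀ F : ℕ → ℝ, ∑ k ∈ Finset.Icc 1 n, F k = ∑ k ∈ Finset.range n, F (n - k) := by
    intro F
    rw [← Finset.sum_range_reflect, Finset.range_eq_Ico, Finset.sum_Ico_eq_sum_range,
      ← Finset.Ico_add_one_right_eq_Icc, Finset.sum_Ico_eq_sum_range]
    refine Finset.sum_congr (by simp) fun k hk => ?_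
    have := Finset.mem_range.1 hk
    congr 1
    omega
  have e1 : ∑ i ∈ Finset.Icc 1 n, G i (n + 1) = ∑ k ∈ Finset.range n, a (k + 1) := by
    rw [r]
    refine Finset.sum_congr rfl fun k hk => ?_
    have := Finset.mem_range.1 hk
    rw [← h1 (n - k) (k + 1)]
    congr 1
    omega
  have e2 : ∑ j ∈ Finset.Icc 1 n, G (n + 1) j = ∑ k ∈ Finset.range n, a (k + 1) := by
    rw [r]
    refine Finset.sum_congr rfl fun k hk => ?_
    have := Finset.mem_range.1 hk
    rw [← h2 (n - k) (k + 1)]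
    congr 1
    omega
  have e3 : G (n + 1) (n + 1) = a 0 := h1 (n + 1) 0
  simp only [Finset.sum_Icc_succ_top (Nat.le_add_left 1 n), Finset.sum_add_distrib, e1, e2, e3]
  ring

variable {H : Type*} [NormedAddCommGroup H] [InnerProductSpace ℝ H]

/-- Lags are grouped in pairs: each term of the variance series takes one odd lag whole and half of
each neighbouring even lag, so half of the last even lag remains. -/
lemma sum_range_pow_odd {P : Module.End ℝ H} (hP : P.IsSymmetric) (f : H) (j : ℕ) :
    ‖f‖ ^ 2 + 2 * ∑ k ∈ Finset.range (2 * j), inner ℝ f ((P ^ (k + 1)) f)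
      = ∑ i ∈ Finset.range j, varTerm P f i + inner ℝ f ((P ^ (2 * j)) f) := by
  induction j with
  | zero => simp
  | succ j ih =>
    rw [mul_add, mul_one, Finset.sum_range_succ, Finset.sum_range_succ, Finset.sum_range_succ,
      varTerm_eq hP]
    linarith

/-- The covariance double sum is, up to a bounded term, a sum of partial sums of the variance
series. -/
lemma sum_covariance_eq {P : Module.End ℝ H} (hP : P.IsSymmetric) (f : H) {G : ℕ → ℕ → ℝ}
    (h1 : ∀ i k, G i (i + k) = inner ℝ f ((P ^ k) f))
    (h2 : ∀ i k, G (i + k) i = inner ℝ f ((P ^ k) f)) (j : ℕ) :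
    (∑ i ∈ Finset.Icc 1 (2 * j), ∑ k ∈ Finset.Icc 1 (2 * j), G i k
      = ∑ m ∈ Finset.range (2 * j), ∑ i ∈ Finset.range ((m + 1) / 2), varTerm P f i
        + (‖f‖ ^ 2 - inner ℝ f ((P ^ (2 * j)) f))) ∧
    ∑ i ∈ Finset.Icc 1 (2 * j + 1), ∑ k ∈ Finset.Icc 1 (2 * j + 1), G i k
      = ∑ m ∈ Finset.range (2 * j + 1), ∑ i ∈ Finset.range ((m + 1) / 2), varTerm P f i
        + ‖f‖ ^ 2 := by
  have h0 : inner ℝ f ((P ^ 0) f) = ‖f‖ ^ 2 := by simp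
  have step : ∀ j, (∑ i ∈ Finset.Icc 1 (2 * j), ∑ k ∈ Finset.Icc 1 (2 * j), G i k
      = ∑ m ∈ Finset.range (2 * j), ∑ i ∈ Finset.range ((m + 1) / 2), varTerm P f i
        + (‖f‖ ^ 2 - inner ℝ f ((P ^ (2 * j)) f))) →
    ∑ i ∈ Finset.Icc 1 (2 * j + 1), ∑ k ∈ Finset.Icc 1 (2 * j + 1), G i k
      = ∑ m ∈ Finset.range (2 * j + 1), ∑ i ∈ Finset.range ((m + 1) / 2), varTerm P f i
        + ‖f‖ ^ 2 := by
    intro j hj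
    rw [sum_Icc_sum_Icc_succ h1 h2, hj, h0, sum_range_pow_odd hP, Finset.sum_range_succ,
      show (2 * j + 1) / 2 = j by omega]
    ring
  induction j with
  | zero => exact ⟨by simp, step 0 (by simp)⟩
  | succ j ih =>
    -- The even case is both the first conjunct and the input to `step`, so it closes both goals.
    refine ⟨?_, step (j + 1) ?_⟩ <;>
    · rw [mul_add, mul_one, sum_Icc_sum_Icc_succ h1 h2, ih.2, h0,
        Finset.sum_range_succ _ (2 * j + 1), show (2 * j + 1 + 1) / 2 = j + 1 by omega]
      have h3 := sum_range_pow_odd hP f (j + 1)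
      rw [mul_add, mul_one, Finset.sum_range_succ] at h3
      linarith

lemma exists_sum_covariance_eq {P : Module.End ℝ H} (hP : P.IsSymmetric)
    (hc : ∀ x, ‖P x‖ ≤ ‖x‖) (f : H) {G : ℕ → ℕ → ℝ}
    (h1 : ∀ i k, G i (i + k) = inner ℝ f ((P ^ k) f))
    (h2 : ∀ i k, G (i + k) i = inner ℝ f ((P ^ k) f)) (n : ℕ) :
    ∃ e : ℝ, 0 ≤ e ∧ e ≤ ‖f‖ ^ 2 ∧ ∑ i ∈ Finset.Icc 1 n, ∑ k ∈ Finset.Icc 1 n, G i k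
      = ∑ m ∈ Finset.range n, ∑ i ∈ Finset.range ((m + 1) / 2), varTerm P f i + e := by
  rcases Nat.even_or_odd' n with ⟨j, rfl | rfl⟩
  · refine ⟨_, ?_, ?_, (sum_covariance_eq hP f h1 h2 j).1⟩ <;> rw [inner_pow_even hP]
    · have := norm_pow_apply_le hc f j
      have := pow_le_pow_left₀ (norm_nonneg _) this 2
      linarith
    · linarith [sq_nonneg ‖(P ^ j) f‖]
  · exact ⟨_, sq_nonneg _, le_rfl, (sum_covariance_eq hP f h1 h2 j).2⟩

/-- Existence of the asymptotic variance, as the sum of the variance series. -/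
lemma tendsto_sum_covariance_div {P : Module.End ℝ H} (hP : P.IsSymmetric)
    (hc : ∀ x, ‖P x‖ ≤ ‖x‖) (f : H) {G : ℕ → ℕ → ℝ}
    (h1 : ∀ i k, G i (i + k) = inner ℝ f ((P ^ k) f))
    (h2 : ∀ i k, G (i + k) i = inner ℝ f ((P ^ k) f)) :
    Tendsto (fun n : ℕ =>
      ENNReal.ofReal (∑ i ∈ Finset.Icc 1 n, ∑ k ∈ Finset.Icc 1 n, G i k) / n) atTop
      (𝓝 (∑' j, ENNReal.ofReal (varTerm P f j))) := by
  choose e he0 he1 he using exists_sum_covariance_eq hP hc f h1 h2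
  set u : ℕ → ℝ≥0∞ := fun m => ∑ i ∈ Finset.range ((m + 1) / 2), ENNReal.ofReal (varTerm P f i)
    with hu
  have hmono : Monotone u := by
    intro m n hmn
    refine Finset.sum_le_sum_of_subset (Finset.range_mono (by omega))
  have hsup : ⨆ m, u m = ∑' j, ENNReal.ofReal (varTerm P f j) := by
    rw [ENNReal.tsum_eq_iSup_nat]
    refine le_antisymm (iSup_le fun m => le_iSup_of_le ((m + 1) / 2) le_rfl)
      (iSup_le fun m => le_iSup_of_le (2 * m) ?_)
    simp only [hu]
    rw [show (2 * m + 1) / 2 = m by omega]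
  have hz : Tendsto (fun n : ℕ => ENNReal.ofReal (e n) / n) atTop (𝓝 0) := by
    have hz' : Tendsto (fun n : ℕ => ENNReal.ofReal (‖f‖ ^ 2) / n) atTop (𝓝 0) :=
      ENNReal.Tendsto.const_div ENNReal.tendsto_nat_nhds_top
        (Or.inr ENNReal.ofReal_ne_top) |>.trans (by simp)
    exact tendsto_of_tendsto_of_tendsto_of_le_of_le tendsto_const_nhds hz' (fun _ => zero_le)
      fun n => ENNReal.div_le_div_right (ENNReal.ofReal_le_ofReal (he1 n)) _
  have hlim := (tendsto_cesaro_ennreal hmono).add hz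
  rw [hsup, add_zero] at hlim
  refine hlim.congr fun n => ?_
  rw [he n, ENNReal.ofReal_add (Finset.sum_nonneg fun m _ =>
      Finset.sum_nonneg fun i _ => varTerm_nonneg P f i) (he0 n), ENNReal.add_div,
    ENNReal.ofReal_sum_of_nonneg fun m _ => Finset.sum_nonneg fun i _ => varTerm_nonneg P f i]
  simp only [hu, ENNReal.ofReal_sum_of_nonneg fun i _ => varTerm_nonneg P f i]

end Cesaro

/-! ### Markov kernels as symmetric contractions on `L²` -/

section KernelOperator

variable {X : Type*} [MeasurableSpace X] {μ : Measure X} {K : Kernel X X}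

lemma integral_kernel_congr_ae (hK : K.Invariant μ) {f g : X → ℝ} (h : f =ᵐ[μ] g) :
    (fun x => ∫ y, f y ∂K x) =ᵐ[μ] fun x => ∫ y, g y ∂K x := by
  have h' : ∀ᵐ x ∂(μ.bind K), f x = g x := by rw [hK.def]; exact h
  filter_upwards [Measure.ae_ae_of_ae_comp h'] with x hx
  exact integral_congr_ae hx

lemma aestronglyMeasurable_integral_kernel [IsSFiniteKernel K] (hK : K.Invariant μ) {f : X → ℝ}
    (hf : AEStronglyMeasurable f μ) :
    AEStronglyMeasurable (fun x => ∫ y, f y ∂K x) μ :=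
  ⟨_, hf.stronglyMeasurable_mk.integral_kernel, integral_kernel_congr_ae hK hf.ae_eq_mk⟩

lemma enorm_integral_sq_le [IsMarkovKernel K] {f : X → ℝ} (hf : StronglyMeasurable f) (x : X) :
    ‖∫ y, f y ∂K x‖ₑ ^ (2 : ℝ) ≤ ∫⁻ y, ‖f y‖ₑ ^ (2 : ℝ) ∂K x := by
  have h1 : ‖∫ y, f y ∂K x‖ₑ ≤ eLpNorm f 2 (K x) :=
    calc ‖∫ y, f y ∂K x‖ₑ ≤ ∫⁻ y, ‖f y‖ₑ ∂K x := enorm_integral_le_lintegral_enorm _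
      _ = eLpNorm f 1 (K x) := eLpNorm_one_eq_lintegral_enorm.symm
      _ ≤ eLpNorm f 2 (K x) :=
        eLpNorm_le_eLpNorm_of_exponent_le one_le_two hf.aestronglyMeasurable
  calc ‖∫ y, f y ∂K x‖ₑ ^ (2 : ℝ) ≤ eLpNorm f 2 (K x) ^ (2 : ℝ) :=
        ENNReal.rpow_le_rpow h1 zero_le_two
    _ = ∫⁻ y, ‖f y‖ₑ ^ (2 : ℝ) ∂K x := by
        have := eLpNorm_nnreal_pow_eq_lintegral (f := f) (μ := K x) (p := 2) two_ne_zero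
        simpa using this

/-- Jensen's inequality under each `K x`, followed by invariance. -/
lemma eLpNorm_integral_kernel_le [IsMarkovKernel K] (hK : K.Invariant μ) {f : X → ℝ}
    (hf : AEStronglyMeasurable f μ) :
    eLpNorm (fun x => ∫ y, f y ∂K x) 2 μ ≤ eLpNorm f 2 μ := by
  rw [eLpNorm_congr_ae hf.ae_eq_mk, eLpNorm_congr_ae (integral_kernel_congr_ae hK hf.ae_eq_mk)]
  set g := hf.mk f
  have hg : StronglyMeasurable g := hf.stronglyMeasurable_mk
  rw [← ENNReal.rpow_le_rpow_iff (z := 2) zero_lt_two]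
  have h1 := eLpNorm_nnreal_pow_eq_lintegral (f := fun x => ∫ y, g y ∂K x) (μ := μ) (p := 2)
    two_ne_zero
  have h2 := eLpNorm_nnreal_pow_eq_lintegral (f := g) (μ := μ) (p := 2) two_ne_zero
  simp only [NNReal.coe_ofNat, ENNReal.coe_ofNat] at h1 h2
  rw [h1, h2]
  calc ∫⁻ x, ‖∫ y, g y ∂K x‖ₑ ^ (2 : ℝ) ∂μ
      ≤ ∫⁻ x, ∫⁻ y, ‖g y‖ₑ ^ (2 : ℝ) ∂K x ∂μ := lintegral_mono (enorm_integral_sq_le hg)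
    _ = ∫⁻ y, ‖g y‖ₑ ^ (2 : ℝ) ∂(μ.bind K) :=
        (Measure.lintegral_bind K.aemeasurable (hg.enorm.pow_const _).aemeasurable).symm
    _ = _ := by rw [hK.def]

lemma memLp_integral_kernel [IsMarkovKernel K] (hK : K.Invariant μ) {f : X → ℝ}
    (hf : MemLp f 2 μ) : MemLp (fun x => ∫ y, f y ∂K x) 2 μ :=
  ⟨aestronglyMeasurable_integral_kernel hK hf.1,
    (eLpNorm_integral_kernel_le hK hf.1).trans_lt hf.2⟩

lemma ae_integrable_kernel [IsProbabilityMeasure μ] (hK : K.Invariant μ) {f : X → ℝ}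
    (hf : MemLp f 2 μ) : ∀ᵐ x ∂μ, Integrable f (K x) := by
  refine Measure.ae_integrable_of_integrable_comp ?_
  rw [hK.def]
  exact hf.integrable one_le_two

/-- The operator `f ↦ ∫ f(y) K(·, dy)` on `L²(μ)`, for `K` leaving `μ` invariant. -/
noncomputable def kernelOp (K : Kernel X X) [IsMarkovKernel K] (μ : Measure X)
    [IsProbabilityMeasure μ] (hK : K.Invariant μ) : Module.End ℝ (Lp ℝ 2 μ) where
  toFun f := (memLp_integral_kernel hK (Lp.memLp f)).toLp _
  map_add' f g := by
    rw [← MemLp.toLp_add]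
    refine MemLp.toLp_congr _ _ ?_
    filter_upwards [integral_kernel_congr_ae hK (Lp.coeFn_add f g),
      ae_integrable_kernel hK (Lp.memLp f), ae_integrable_kernel hK (Lp.memLp g)] with x hx hf hg
    rw [hx]
    exact integral_add hf hg
  map_smul' c f := by
    rw [RingHom.id_apply, ← MemLp.toLp_const_smul]
    refine MemLp.toLp_congr _ _ ?_
    filter_upwards [integral_kernel_congr_ae hK (Lp.coeFn_smul c f)] with x hx
    rw [hx]
    exact integral_const_mul c _

lemma toLp_inner {f g : X → ℝ} (hf : MemLp f 2 μ) (hg : MemLp g 2 μ) :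
    inner ℝ (hf.toLp f) (hg.toLp g) = ∫ x, f x * g x ∂μ := by
  rw [L2.inner_def]
  refine integral_congr_ae ?_
  filter_upwards [hf.coeFn_toLp, hg.coeFn_toLp] with x h1 h2
  rw [h1, h2, RCLike.inner_apply, conj_trivial, mul_comm]

lemma inner_eq_integral (f g : Lp ℝ 2 μ) : inner ℝ f g = ∫ x, f x * g x ∂μ := by
  rw [L2.inner_def]
  simp only [RCLike.inner_apply, conj_trivial, mul_comm]

variable [IsMarkovKernel K] [IsProbabilityMeasure μ]

lemma coeFn_kernelOp (hK : K.Invariant μ) (f : Lp ℝ 2 μ) :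
    kernelOp K μ hK f =ᵐ[μ] fun x => ∫ y, f y ∂K x :=
  MemLp.coeFn_toLp (memLp_integral_kernel hK (Lp.memLp f))

lemma kernelOp_toLp (hK : K.Invariant μ) {f : X → ℝ} (hf : MemLp f 2 μ) :
    kernelOp K μ hK (hf.toLp f) = (memLp_integral_kernel hK hf).toLp _ :=
  MemLp.toLp_congr (memLp_integral_kernel hK (Lp.memLp _)) _
    (integral_kernel_congr_ae hK hf.coeFn_toLp)

lemma norm_kernelOp_le (hK : K.Invariant μ) (f : Lp ℝ 2 μ) : ‖kernelOp K μ hK f‖ ≤ ‖f‖ := by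
  rw [Lp.norm_def, Lp.norm_def]
  refine ENNReal.toReal_mono (Lp.eLpNorm_ne_top f) ?_
  rw [eLpNorm_congr_ae (coeFn_kernelOp hK f)]
  exact eLpNorm_integral_kernel_le hK (Lp.aestronglyMeasurable f)

lemma measurePreserving_fst_compProd : MeasurePreserving Prod.fst (μ ⊗ₘ K) μ :=
  ⟨measurable_fst, Measure.fst_compProd μ K⟩

lemma measurePreserving_snd_compProd (hK : K.Invariant μ) :
    MeasurePreserving Prod.snd (μ ⊗ₘ K) μ :=
  ⟨measurable_snd, (Measure.snd_compProd μ K).trans hK.def⟩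

lemma integral_mul_integral_kernel (hK : K.Invariant μ) {f g : X → ℝ} (hf : MemLp f 2 μ)
    (hg : MemLp g 2 μ) :
    ∫ x, f x * ∫ y, g y ∂K x ∂μ = ∫ p, f p.1 * g p.2 ∂(μ ⊗ₘ K) := by
  have hint : Integrable (fun p : X × X => f p.1 * g p.2) (μ ⊗ₘ K) :=
    (hf.comp_measurePreserving measurePreserving_fst_compProd).integrable_mul
      (hg.comp_measurePreserving (measurePreserving_snd_compProd hK))
  rw [Measure.integral_compProd hint]
  simp only [integral_const_mul]

lemma map_swap_compProd (hK : K.IsReversible μ) : (μ ⊗ₘ K).map Prod.swap = μ ⊗ₘ K := by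
  have : IsFiniteMeasure ((μ ⊗ₘ K).map Prod.swap) := Measure.isFiniteMeasure_map _ _
  refine Measure.ext_prod fun {s t} hs ht => ?_
  rw [Measure.map_apply measurable_swap (hs.prod ht), Set.preimage_swap_prod,
    Measure.compProd_apply_prod ht hs, Measure.compProd_apply_prod hs ht]
  exact hK ht hs

lemma kernelOp_isSymmetric (hK : K.Invariant μ) (hrev : K.IsReversible μ) :
    (kernelOp K μ hK).IsSymmetric := by
  intro f g
  have key : ∀ u v : Lp ℝ 2 μ, inner ℝ u (kernelOp K μ hK v)
      = ∫ p, u p.1 * v p.2 ∂(μ ⊗ₘ K) := by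
    intro u v
    rw [inner_eq_integral, ← integral_mul_integral_kernel hK (Lp.memLp u) (Lp.memLp v)]
    refine integral_congr_ae ?_
    filter_upwards [coeFn_kernelOp hK v] with x hx
    rw [hx]
  have h1 : MeasurePreserving (MeasurableEquiv.prodComm (α := X) (β := X)) (μ ⊗ₘ K) (μ ⊗ₘ K) :=
    ⟨MeasurableEquiv.prodComm.measurable, map_swap_compProd hrev⟩
  rw [real_inner_comm, key, key, ← h1.integral_comp']
  simp [mul_comm, MeasurableEquiv.prodComm]

lemma dirichletForm_eq_inner (hK : K.Invariant μ) {f : X → ℝ} (hf : MemLp f 2 μ) :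
    dirichletForm K μ f
      = inner ℝ (hf.toLp f) (hf.toLp f - kernelOp K μ hK (hf.toLp f)) := by
  rw [kernelOp_toLp, ← MemLp.toLp_sub, toLp_inner]
  rfl

end KernelOperator

/-! ### Covariances of the stationary chain -/

section Chain

variable {X : Type*} [MeasurableSpace X] {μ : Measure X} {K : Kernel X X} [IsMarkovKernel K]

lemma map_chainLaw_zero : (chainLaw μ K).map (fun ω => ω 0) = μ := by
  have h : (fun ω : ℕ → X => ω 0) = (MeasurableEquiv.piUnique fun _ : Finset.Iic 0 => X) ∘
      Preorder.frestrictLe (π := fun _ : ℕ => X) 0 := rfl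
  rw [h, ← Measure.map_map (MeasurableEquiv.measurable _) (by fun_prop), chainLaw,
    Kernel.trajMeasure, Measure.map_comp _ _ (by fun_prop), Kernel.traj_map_frestrictLe,
    Kernel.partialTraj_self, Measure.id_comp, MeasurableEquiv.map_map_symm]

variable [IsProbabilityMeasure μ]

instance : IsProbabilityMeasure (chainLaw μ K) := by
  unfold chainLaw
  infer_instance

/-- The joint law of the history up to time `n` and of the next state. -/
lemma map_history_compProd_chainLaw (n : ℕ) :
    ((chainLaw μ K).map (Preorder.frestrictLe (π := fun _ : ℕ => X) n)) ⊗ₘ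
        (K.comap (fun h : (i : Finset.Iic n) → X => h ⟨n, Finset.mem_Iic.mpr le_rfl⟩)
          (measurable_pi_apply _))
      = (chainLaw μ K).map (fun ω => (Preorder.frestrictLe (π := fun _ : ℕ => X) n ω, ω (n + 1))) :=
  Kernel.map_frestrictLe_trajMeasure_compProd_eq_map_trajMeasure

lemma map_chainLaw (hK : K.Invariant μ) (n : ℕ) : (chainLaw μ K).map (fun ω => ω n) = μ := by
  induction n with
  | zero => exact map_chainLaw_zero
  | succ n ih =>
    have h := congrArg Measure.snd (map_history_compProd_chainLaw (μ := μ) (K := K) n)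
    rw [Measure.snd_compProd, Measure.snd, Measure.map_map measurable_snd (by fun_prop)] at h
    change _ = (chainLaw μ K).map (fun ω => ω (n + 1)) at h
    rw [← h]
    ext s hs
    rw [Measure.bind_apply hs (Kernel.aemeasurable _)]
    simp only [Kernel.comap_apply]
    rw [lintegral_map (f := fun h : (i : Finset.Iic n) → X =>
        K (h ⟨n, Finset.mem_Iic.mpr le_rfl⟩) s)
      ((K.measurable_coe hs).comp (measurable_pi_apply _)) (by fun_prop)]
    change ∫⁻ ω, K (ω n) s ∂(chainLaw μ K) = μ s
    rw [← lintegral_map (f := fun x => K x s) (K.measurable_coe hs) (measurable_pi_apply n), ih,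
      ← Measure.bind_apply hs K.aemeasurable, hK.def]

lemma measurePreserving_chainLaw (hK : K.Invariant μ) (n : ℕ) :
    MeasurePreserving (fun ω : ℕ → X => ω n) (chainLaw μ K) μ :=
  ⟨measurable_pi_apply n, map_chainLaw hK n⟩

lemma integrable_mul_chainLaw (hK : K.Invariant μ) {f g : X → ℝ} (hf : MemLp f 2 μ)
    (hg : MemLp g 2 μ) (i j : ℕ) : Integrable (fun ω => f (ω i) * g (ω j)) (chainLaw μ K) :=
  (hf.comp_measurePreserving (measurePreserving_chainLaw hK i)).integrable_mul
    (hg.comp_measurePreserving (measurePreserving_chainLaw hK j))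

/-- The Markov property: the next state is integrated out given the history up to time `n`, which
contains the state at time `i`. -/
lemma integral_mul_chainLaw_succ (hK : K.Invariant μ) {f g : X → ℝ} (hf : MemLp f 2 μ)
    (hg : MemLp g 2 μ) (hfm : StronglyMeasurable f) (hgm : StronglyMeasurable g) {i n : ℕ}
    (hi : i ≤ n) :
    ∫ ω, f (ω i) * g (ω (n + 1)) ∂(chainLaw μ K)
      = ∫ ω, f (ω i) * ∫ y, g y ∂K (ω n) ∂(chainLaw μ K) := by
  set F : ((_ : Finset.Iic n) → X) × X → ℝ :=
    fun p => f (p.1 ⟨i, Finset.mem_Iic.mpr hi⟩) * g p.2 with hF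
  have hFm : StronglyMeasurable F := by
    refine (hfm.comp_measurable ?_).mul (hgm.comp_measurable measurable_snd)
    exact (measurable_pi_apply _).comp measurable_fst
  have hm : Measurable (fun ω : ℕ → X => (Preorder.frestrictLe (π := fun _ : ℕ => X) n ω,
      ω (n + 1))) := by fun_prop
  have hint : Integrable F ((chainLaw μ K).map
      (fun ω => (Preorder.frestrictLe (π := fun _ : ℕ => X) n ω, ω (n + 1)))) := by
    rw [integrable_map_measure hFm.aestronglyMeasurable hm.aemeasurable]
    exact integrable_mul_chainLaw hK hf hg i (n + 1)
  have h1 : ∫ ω, f (ω i) * g (ω (n + 1)) ∂(chainLaw μ K) = ∫ p, F p ∂((chainLaw μ K).map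
      (fun ω => (Preorder.frestrictLe (π := fun _ : ℕ => X) n ω, ω (n + 1)))) := by
    rw [integral_map hm.aemeasurable hFm.aestronglyMeasurable]
    rfl
  rw [← map_history_compProd_chainLaw] at hint h1
  rw [h1, Measure.integral_compProd hint]
  simp only [hF, integral_const_mul, Kernel.comap_apply]
  rw [integral_map (by fun_prop)]
  · rfl
  · refine StronglyMeasurable.aestronglyMeasurable ?_
    exact (hfm.comp_measurable (measurable_pi_apply _)).mul
      (hgm.integral_kernel.comp_measurable (measurable_pi_apply _))

/-- Covariances of the stationary chain in terms of powers of the kernel operator. -/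
lemma integral_mul_chainLaw (hK : K.Invariant μ) (f g : Lp ℝ 2 μ) (i k : ℕ) :
    ∫ ω, f (ω i) * g (ω (i + k)) ∂(chainLaw μ K)
      = inner ℝ f ((kernelOp K μ hK ^ k) g) := by
  induction k generalizing g with
  | zero =>
    rw [pow_zero, Module.End.one_apply, inner_eq_integral, add_zero]
    have h := integral_map (μ := chainLaw μ K) (f := fun x => f x * g x)
      (measurable_pi_apply i).aemeasurable
      ((Lp.stronglyMeasurable f).mul (Lp.stronglyMeasurable g)).aestronglyMeasurable
    rw [← h, map_chainLaw hK i]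
  | succ k ih =>
    rw [pow_succ, Module.End.mul_apply, ← ih, ← add_assoc,
      integral_mul_chainLaw_succ hK (Lp.memLp f) (Lp.memLp g) (Lp.stronglyMeasurable f)
        (Lp.stronglyMeasurable g) (Nat.le_add_right i k)]
    refine integral_congr_ae ?_
    filter_upwards [(measurePreserving_chainLaw hK (i + k)).quasiMeasurePreserving.ae
      (coeFn_kernelOp hK g)] with ω hω
    rw [hω]

/-- Existence of the asymptotic variance of a reversible chain, as a series in the kernel
operator applied to the centred function. -/
lemma hasAsymVar_tsum (hK : K.Invariant μ) (hrev : K.IsReversible μ) {f : X → ℝ}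
    (hf : MemLp (fun x => f x - ∫ z, f z ∂μ) 2 μ) :
    HasAsymVar K μ f (∑' j, ENNReal.ofReal (varTerm (kernelOp K μ hK) (hf.toLp _) j)) := by
  set F := hf.toLp _
  have hG1 : ∀ i k : ℕ, ∫ ω, F (ω i) * F (ω (i + k)) ∂(chainLaw μ K)
      = inner ℝ F ((kernelOp K μ hK ^ k) F) := integral_mul_chainLaw hK F F
  have hG2 : ∀ i k : ℕ, ∫ ω, F (ω (i + k)) * F (ω i) ∂(chainLaw μ K)
      = inner ℝ F ((kernelOp K μ hK ^ k) F) := by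
    intro i k
    rw [← hG1 i k]
    simp only [mul_comm]
  refine (tendsto_sum_covariance_div (kernelOp_isSymmetric hK hrev) (norm_kernelOp_le hK) F
    (G := fun i j => ∫ ω, F (ω i) * F (ω j) ∂(chainLaw μ K)) hG1 hG2).congr fun n => ?_
  rw [asymVarSeq]
  congr 1
  have hint : ∀ i j : ℕ, Integrable (fun ω => F (ω i) * F (ω j)) (chainLaw μ K) :=
    integrable_mul_chainLaw hK (Lp.memLp F) (Lp.memLp F)
  have hsq : ∀ ω : ℕ → X, (∑ k ∈ Finset.Icc 1 n, F (ω k)) ^ 2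
      = ∑ i ∈ Finset.Icc 1 n, ∑ j ∈ Finset.Icc 1 n, F (ω i) * F (ω j) := fun ω => by
    rw [sq, Finset.sum_mul_sum]
  have hint2 : Integrable (fun ω : ℕ → X => (∑ k ∈ Finset.Icc 1 n, F (ω k)) ^ 2)
      (chainLaw μ K) := by
    simp only [hsq]
    exact integrable_finsetSum _ fun i _ => integrable_finsetSum _ fun j _ => hint i j
  have hae : ∀ᵐ ω ∂(chainLaw μ K), ∀ k : ℕ, F (ω k) = f (ω k) - ∫ z, f z ∂μ :=
    ae_all_iff.2 fun k => (measurePreserving_chainLaw hK k).quasiMeasurePreserving.ae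
      hf.coeFn_toLp
  calc ENNReal.ofReal (∑ i ∈ Finset.Icc 1 n, ∑ k ∈ Finset.Icc 1 n,
        ∫ ω, F (ω i) * F (ω k) ∂(chainLaw μ K))
      = ENNReal.ofReal (∫ ω, (∑ k ∈ Finset.Icc 1 n, F (ω k)) ^ 2 ∂(chainLaw μ K)) := by
        simp only [hsq]
        rw [integral_finsetSum _ fun i _ => integrable_finsetSum _ fun j _ => hint i j]
        simp only [integral_finsetSum _ fun j _ => hint _ j]
    _ = ∫⁻ ω, ENNReal.ofReal ((∑ k ∈ Finset.Icc 1 n, F (ω k)) ^ 2) ∂(chainLaw μ K) :=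
        ofReal_integral_eq_lintegral_ofReal hint2 (ae_of_all _ fun _ => sq_nonneg _)
    _ = _ := by
        refine lintegral_congr_ae ?_
        filter_upwards [hae] with ω hω
        simp only [hω]

end Chain

/-! ### Conditional means given the first coordinate -/

section Augmentation

variable {T Y : Type*} [MeasurableSpace T] [MeasurableSpace Y]

/-- The square-integrable functions of the first coordinate. -/
noncomputable def fstFunctions (μ : Measure (T × Y)) : Submodule ℝ (Lp ℝ 2 μ) where
  carrier := {u | ∃ g : T → ℝ, StronglyMeasurable g ∧ u =ᵐ[μ] fun x => g x.1}
  add_mem' := by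
    rintro u v ⟨g, hg, hu⟩ ⟨h, hh, hv⟩
    refine ⟨g + h, hg.add hh, (Lp.coeFn_add u v).trans ?_⟩
    filter_upwards [hu, hv] with x h1 h2
    simp [h1, h2]
  zero_mem' := ⟨0, stronglyMeasurable_zero, Lp.coeFn_zero ℝ 2 μ⟩
  smul_mem' := by
    rintro c u ⟨g, hg, hu⟩
    refine ⟨c • g, hg.const_smul c, (Lp.coeFn_smul c u).trans ?_⟩
    filter_upwards [hu] with x h1
    simp [h1]

lemma memLp_fst {μ : Measure (T × Y)} {g : T → ℝ} (hg : StronglyMeasurable g) :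
    MemLp g 2 μ.fst ↔ MemLp (fun x : T × Y => g x.1) 2 μ :=
  memLp_map_measure_iff hg.aestronglyMeasurable measurable_fst.aemeasurable

lemma kernelOp_mem_fstFunctions {μ : Measure (T × Y)} [IsProbabilityMeasure μ]
    {K : Kernel (T × Y) (T × Y)} [IsMarkovKernel K] (hK : K.Invariant μ)
    (h : ∀ t y y', K (t, y) = K (t, y')) (u : Lp ℝ 2 μ) : kernelOp K μ hK u ∈ fstFunctions μ := by
  -- The kernel ignores the second coordinate, so freezing it at any point gives a measurable
  -- representative in `t`.
  obtain ⟨⟨-, y₀⟩⟩ := nonempty_of_isProbabilityMeasure μ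
  refine ⟨fun t => ∫ z, u z ∂K (t, y₀),
    (Lp.stronglyMeasurable u).integral_kernel.comp_measurable measurable_prodMk_right, ?_⟩
  filter_upwards [coeFn_kernelOp hK u] with x hx
  rw [hx, h x.1 y₀ x.2]

/-- The kernel on `T × Y` that refreshes the second coordinate from `Q`. -/
noncomputable def refreshKernel (Q : Kernel T Y) : Kernel (T × Y) (T × Y) :=
  (Kernel.id ×ₖ Q).comap Prod.fst measurable_fst

instance (Q : Kernel T Y) [IsMarkovKernel Q] : IsMarkovKernel (refreshKernel Q) := by
  unfold refreshKernel
  infer_instance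

variable {Q : Kernel T Y} [IsMarkovKernel Q]

lemma refreshKernel_apply (x : T × Y) :
    refreshKernel Q x = (Q x.1).map (Prod.mk x.1) := by
  rw [refreshKernel, Kernel.comap_apply, Kernel.prod_apply, Kernel.id_apply, Measure.dirac_prod]

lemma integral_refreshKernel {f : T × Y → ℝ} (hf : StronglyMeasurable f) (x : T × Y) :
    ∫ z, f z ∂refreshKernel Q x = ∫ y, f (x.1, y) ∂Q x.1 := by
  rw [refreshKernel_apply, integral_map measurable_prodMk_left.aemeasurable
    hf.aestronglyMeasurable]

lemma refreshKernel_invariant (m : Measure T) [SFinite m] :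
    (refreshKernel Q).Invariant (m ⊗ₘ Q) := by
  ext s hs
  rw [Measure.bind_apply hs (Kernel.aemeasurable _),
    Measure.lintegral_compProd (Kernel.measurable_coe _ hs), Measure.compProd_apply hs]
  refine lintegral_congr fun t => ?_
  simp [refreshKernel_apply, Measure.map_apply measurable_prodMk_left hs]

/-- A function of the first coordinate is constant under refreshing, so it can be pulled inside the
kernel integral. Invariance then removes the kernel. -/
lemma inner_refresh {μ : Measure (T × Y)} [IsProbabilityMeasure μ]
    (hμ : (refreshKernel Q).Invariant μ) (f g : Lp ℝ 2 μ) (hg : g ∈ fstFunctions μ) :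
    inner ℝ (kernelOp (refreshKernel Q) μ hμ f) g = inner ℝ f g := by
  obtain ⟨h, hh, hgh⟩ := hg
  have hint : Integrable (fun z => f z * h z.1) (μ.bind (refreshKernel Q)) := by
    rw [hμ.def]
    exact ((Lp.memLp f).integrable_mul (Lp.memLp g)).congr
      (by filter_upwards [hgh] with x hx; simp [hx])
  rw [inner_eq_integral, inner_eq_integral]
  calc ∫ x, kernelOp (refreshKernel Q) μ hμ f x * g x ∂μ
      = ∫ x, ∫ z, f z * h z.1 ∂refreshKernel Q x ∂μ := by
        refine integral_congr_ae ?_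
        filter_upwards [hgh, coeFn_kernelOp hμ f] with x h1 h2
        rw [h1, h2, integral_refreshKernel (Lp.stronglyMeasurable f),
          integral_refreshKernel (f := fun z => f z * h z.1) ((Lp.stronglyMeasurable f).mul
            (hh.comp_measurable measurable_fst))]
        exact (integral_mul_const _ _).symm
    _ = ∫ z, f z * h z.1 ∂(μ.bind (refreshKernel Q)) := by
        rw [Measure.comp_eq_comp_const_apply] at hint ⊢
        rw [Kernel.integral_comp hint, Kernel.const_apply]
    _ = ∫ z, f z * g z ∂μ := by
        rw [hμ.def]
        refine integral_congr_ae ?_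
        filter_upwards [hgh] with x hx
        rw [hx]

lemma kernelOp_kernelOp {X : Type*} [MeasurableSpace X] {μ : Measure X} [IsProbabilityMeasure μ]
    {K J : Kernel X X} [IsMarkovKernel K] [IsMarkovKernel J] (hK : K.Invariant μ)
    (hJ : J.Invariant μ) (h : J ∘ₖ K = K) (f : Lp ℝ 2 μ) :
    kernelOp K μ hK (kernelOp J μ hJ f) = kernelOp K μ hK f := by
  refine Lp.ext ?_
  filter_upwards [coeFn_kernelOp hK (kernelOp J μ hJ f), coeFn_kernelOp hK f,
    integral_kernel_congr_ae hK (coeFn_kernelOp hJ f),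
    ae_integrable_kernel hK (Lp.memLp f)] with x h1 h2 h3 h4
  rw [h1, h2, h3]
  rw [← h] at h4
  rw [← Kernel.integral_comp h4, h]

/-- The function `h` need not be measurable: by disintegration, `f (t, ·)` equals the constant `h t`
almost everywhere for `Q t`, for `m`-almost every `t`, so its `Q t`-mean is `h t`. -/
lemma refresh_eq_self {m : Measure T} [IsProbabilityMeasure m]
    (f : Lp ℝ 2 (m ⊗ₘ Q)) {h : T → ℝ} (hf : ∀ᵐ x ∂(m ⊗ₘ Q), f x = h x.1) :
    kernelOp (refreshKernel Q) (m ⊗ₘ Q) (refreshKernel_invariant m) f = f := by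
  refine Lp.ext ?_
  have h1 : ∀ᵐ t ∂m, ∫ y, f (t, y) ∂Q t = h t := by
    filter_upwards [Measure.ae_ae_of_ae_compProd hf] with t ht
    rw [integral_congr_ae ht]
    simp
  have h2 : MeasurePreserving Prod.fst (m ⊗ₘ Q) m := ⟨measurable_fst, Measure.fst_compProd m Q⟩
  filter_upwards [coeFn_kernelOp (refreshKernel_invariant m) f, hf,
    h2.quasiMeasurePreserving.ae h1] with x e1 e2 e3
  rw [e1, e2, integral_refreshKernel (Lp.stronglyMeasurable f), e3]

end Augmentation

/-! ### Change of measure and centring -/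

section Weights

variable {X : Type*} [MeasurableSpace X]

lemma IsISTriplet.integral_eq {μ ν : Measure X} [SigmaFinite μ] [SigmaFinite ν] {w : X → ℝ≥0}
    (h : IsISTriplet μ ν w) (g : X → ℝ) : ∫ x, g x ∂ν = ∫ x, (w x : ℝ) * g x ∂μ := by
  conv_lhs => rw [← Measure.withDensity_rnDeriv_eq ν μ h.absolutelyContinuous,
    withDensity_congr_ae h.rnDeriv_eq, integral_withDensity_eq_integral_smul h.measurable]
  rfl

lemma integral_weightedCentred {μ ν : Measure X} [SigmaFinite μ] [IsProbabilityMeasure ν]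
    {w : X → ℝ≥0} (h : IsISTriplet μ ν w) {φ : X → ℝ} (hφ : MemLp φ 2 ν) :
    ∫ x, weightedCentred ν w φ x ∂μ = 0 := by
  have := h.integral_eq fun x => φ x - ∫ z, φ z ∂ν
  rw [integral_sub (hφ.integrable one_le_two) (integrable_const _)] at this
  simpa [weightedCentred] using this.symm

lemma evariance_eq_norm_sq {μ : Measure X} {f : X → ℝ}
    (hf : MemLp (fun x => f x - ∫ z, f z ∂μ) 2 μ) :
    evariance f μ = ENNReal.ofReal (‖hf.toLp _‖ ^ 2) := by
  have hint : Integrable (fun x => (f x - ∫ z, f z ∂μ) * (f x - ∫ z, f z ∂μ)) μ :=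
    hf.integrable_mul hf
  rw [← real_inner_self_eq_norm_sq, toLp_inner, ofReal_integral_eq_lintegral_ofReal hint
    (ae_of_all _ fun x => mul_self_nonneg _), evariance]
  refine lintegral_congr fun x => ?_
  rw [Real.enorm_eq_ofReal_abs, ← ENNReal.ofReal_pow (abs_nonneg _), sq_abs, sq]

end Weights

/-! ### Comparison for the conditional mean -/

section Main

variable {T Y : Type*} [MeasurableSpace T] [MeasurableSpace Y]
  {μ ν : Measure (T × Y)} [IsProbabilityMeasure μ] [IsProbabilityMeasure ν] {w : T × Y → ℝ≥0}
  {K L : Kernel (T × Y) (T × Y)} [IsMarkovKernel K] [IsMarkovKernel L] {cl cu : ℝ≥0}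

/-- This domination makes every `L²(μ*)` test function also an `L²(ν*)` one. -/
lemma MarginalComparison.fst_le (h : MarginalComparison μ ν w K L cl cu) :
    ν.fst ≤ (cu : ℝ≥0∞) • μ.fst := by
  have hac : ν.fst ≪ μ.fst := h.triplet.absolutelyContinuous.map measurable_fst
  rw [← Measure.withDensity_rnDeriv_eq ν.fst μ.fst hac, ← withDensity_const]
  exact withDensity_mono h.weight_upper

lemma MarginalComparison.upper_ne_zero (h : MarginalComparison μ ν w K L cl cu) : cu ≠ 0 := by
  rintro rfl
  have := h.fst_le Set.univ
  simp at this

/-- Variance comparison for the conditional mean of the weighted function given the first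
coordinate. -/
lemma tsum_varTerm_refresh_le (h : MarginalComparison μ ν w K L cl cu) {Q : Kernel T Y}
    [IsMarkovKernel Q] (hQ : (refreshKernel Q).Invariant μ)
    (hKfst : ∀ t y y', K (t, y) = K (t, y')) {φ : T × Y → ℝ}
    (hφ : MemLp (fun x => φ x - ∫ z, φ z ∂ν) 2 ν) (hwφ : MemLp (weightedCentred ν w φ) 2 μ) :
    ∑' j, ENNReal.ofReal (varTerm (kernelOp K μ h.harris_K.invariant)
        (kernelOp (refreshKernel Q) μ hQ (hwφ.toLp _)) j)
      + ENNReal.ofReal (‖kernelOp (refreshKernel Q) μ hQ (hwφ.toLp _)‖ ^ 2)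
      ≤ cu * (∑' j, ENNReal.ofReal (varTerm (kernelOp L ν h.harris_L.invariant) (hφ.toLp _) j)
        + ENNReal.ofReal (‖hφ.toLp _‖ ^ 2)) := by
  refine tsum_varTerm_add_le (S := fstFunctions μ) (kernelOp_isSymmetric _ h.reversible_K)
    (norm_kernelOp_le _) (kernelOp_isSymmetric _ h.reversible_L) (norm_kernelOp_le _)
    (kernelOp_mem_fstFunctions _ hKfst) (kernelOp_mem_fstFunctions _ (fun t y y' => ?_) _)
    h.upper_ne_zero fun g hg => ?_
  · rw [refreshKernel_apply, refreshKernel_apply]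
  rw [inner_refresh hQ _ _ hg]
  obtain ⟨k, hk, hgk⟩ := hg
  have hkμ : MemLp (fun x : T × Y => k x.1) 2 μ := (memLp_congr_ae hgk).1 (Lp.memLp g)
  have hkμ' : MemLp k 2 μ.fst := (memLp_fst hk).2 hkμ
  have hkν : MemLp (fun x : T × Y => k x.1) 2 ν :=
    (memLp_fst hk).1 (hkμ'.of_measure_le_smul ENNReal.coe_ne_top h.fst_le)
  have hg' : g = hkμ.toLp _ := Lp.ext (hgk.trans hkμ.coeFn_toLp.symm)
  refine ⟨hkν.toLp _, ?_, ?_⟩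
  · rw [hg', toLp_inner, toLp_inner, h.triplet.integral_eq]
    simp only [weightedCentred, mul_assoc]
  · rw [hg', ← dirichletForm_eq_inner, ← dirichletForm_eq_inner]
    exact h.dirichlet_upper k hkμ'

end Main

end PeskunIS

theorem mainTheorem5 {T Y : Type*} [MeasurableSpace T] [MeasurableSpace Y]
    (μ ν : Measure (T × Y)) [IsProbabilityMeasure μ] [IsProbabilityMeasure ν]
    (w : T × Y → ℝ≥0)
    (K L : Kernel (T × Y) (T × Y)) [IsMarkovKernel K] [IsMarkovKernel L]
    (cl cu : ℝ≥0) (hcomp : PeskunIS.MarginalComparison μ ν w K L cl cu)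
    (K' : Kernel T T) (μ' : Measure T) (Q : Kernel T Y)
    (haug : PeskunIS.IsAugmentation K μ K' μ' Q)
    (φ : T × Y → ℝ) (hφ : MemLp φ 2 ν)
    (hwφ : MemLp (PeskunIS.weightedCentred ν w φ) 2 μ) :
    ∃ vK vL : ℝ≥0∞,
      PeskunIS.HasAsymVar K μ (PeskunIS.weightedCentred ν w φ) vK ∧
      PeskunIS.HasAsymVar L ν φ vL ∧
      vK ≤ (cu : ℝ≥0∞) * (vL + evariance φ ν)
        + (1 + 2 * PeskunIS.negConst K μ) * evariance (PeskunIS.weightedCentred ν w φ) μ ∧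
      ((∃ h : T → ℝ, ∀ᵐ x ∂μ, PeskunIS.weightedCentred ν w φ x = h x.1) →
        vK + evariance (PeskunIS.weightedCentred ν w φ) μ
          ≤ (cu : ℝ≥0∞) * (vL + evariance φ ν)) := by
  obtain ⟨_, _, _, -, hkernel, rfl⟩ := haug
  have hK := hcomp.harris_K.invariant
  have hL := hcomp.harris_L.invariant
  have hQ : (PeskunIS.refreshKernel Q).Invariant (μ' ⊗ₘ Q) := PeskunIS.refreshKernel_invariant μ'
  have hφc : MemLp (fun x => φ x - ∫ z, φ z ∂ν) 2 ν := hφ.sub (memLp_const _)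
  -- Since `μ(w φ̄) = ν(φ̄) = 0`, the centring built into the asymptotic variance has no effect.
  have hcentred : (fun x => PeskunIS.weightedCentred ν w φ x
      - ∫ z, PeskunIS.weightedCentred ν w φ z ∂(μ' ⊗ₘ Q)) = PeskunIS.weightedCentred ν w φ := by
    simp only [PeskunIS.integral_weightedCentred hcomp.triplet hφ, sub_zero]
  have hwφc : MemLp (fun x => PeskunIS.weightedCentred ν w φ x
      - ∫ z, PeskunIS.weightedCentred ν w φ z ∂(μ' ⊗ₘ Q)) 2 (μ' ⊗ₘ Q) := by
    rwa [hcentred]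
  have hF : hwφc.toLp _ = hwφ.toLp _ := by simp only [hcentred]
  have hvarK := PeskunIS.hasAsymVar_tsum hK hcomp.reversible_K hwφc
  have hevK := PeskunIS.evariance_eq_norm_sq hwφc
  rw [hF] at hvarK hevK
  -- Each `K x` has the form `m ⊗ₘ Q`, and such a measure is invariant under refreshing.
  have hcompK : PeskunIS.refreshKernel Q ∘ₖ K = K := by
    ext x : 1
    rw [Kernel.comp_apply, hkernel x.1 x.2]
    exact PeskunIS.refreshKernel_invariant (K' x.1)
  have hmain := PeskunIS.tsum_varTerm_refresh_le hcomp hQ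
    (fun t y y' => by rw [hkernel, hkernel]) hφc hwφ
  rw [← PeskunIS.evariance_eq_norm_sq hφc] at hmain
  refine ⟨_, _, hvarK, PeskunIS.hasAsymVar_tsum hL hcomp.reversible_L hφc, ?_, ?_⟩
  · have hshift := PeskunIS.tsum_varTerm_add_norm_sq
      (PeskunIS.kernelOp_isSymmetric hK hcomp.reversible_K)
      (PeskunIS.kernelOp_kernelOp hK hQ hcompK (hwφ.toLp _)).symm
    rw [hevK]
    -- With `f = w φ̄`, this discards `‖Q f‖²` from `var(K, f) + ‖Q f‖² = var(K, Q f) + ‖f‖²` and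
    -- from the bound on `var(K, Q f) + ‖Q f‖²`. The correction is thus `‖f‖²` with constant `1`, at
    -- most `1 + 2 𝒩_K`.
    refine (le_self_add.trans hshift.le).trans (add_le_add (le_self_add.trans hmain) ?_)
    exact le_mul_of_one_le_left' le_self_add
  · rintro ⟨h, hh⟩
    have hself : PeskunIS.kernelOp (PeskunIS.refreshKernel Q) (μ' ⊗ₘ Q) hQ (hwφ.toLp _)
        = hwφ.toLp _ := PeskunIS.refresh_eq_self _ (h := h) <| by
      filter_upwards [hh, hwφ.coeFn_toLp] with x h1 h2
      rw [h2, h1]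
    rwa [hself, ← hevK] at hmain
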